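/- Let $G$ be a Polish group (with its Borel $\sigma$-algebra) and let $(X,\lambda)$ be a standard $\sigma$-finite space, i.e. a standard Borel space $X$ with a nonzero atomless $\sigma$-finite measure $\lambda$. Let $\alpha$ be a boolean measure-preserving $G$-action on $(X,\lambda)$, i.e. a Borel map $\alpha:G\times X\to X$ such that for all $g,h\in G$ one has $\alpha(gh,x)=\alpha(g,\alpha(h,x))$ for $\lambda$-almost every $x\in X$, and such that for every $g\in G$ the map $\alpha(g,\cdot)$ is a measure-preserving bijection of $(X,\lambda)$. Call $f\in \mathrm L^\infty(X,\lambda)$ (complex-valued) $G$-continuous if $\|f-f\circ\alpha(g^{-1},\cdot)\|_\infty\to 0$ as $g\to e_G$, and let $\mathcal G\subseteq \mathrm L^\infty(X,\lambda)$ be the set of $G$-continuous functions. A measure on the Borel $\sigma$-algebra of a Hausdorff space is called Radon if it is finite on compact sets, inner regular on open sets (by compact sets), and outer regular on Borel sets (by open sets). Then the following are equivalent: (1) $\overline{\mathcal G\cap \mathrm L^1(X,\lambda)}^{\|\cdot\|_1}=\mathrm L^1(X,\lambda)$; (2) $\overline{\mathcal G\cap \mathrm L^2(X,\lambda)}^{\|\cdot\|_2}=\mathrm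 L^2(X,\lambda)$; (3) $\alpha$ admits a continuous Radon model: there are a locally compact Polish space $Y$, a Radon measure $\eta$ on $Y$, a continuous $\eta$-preserving action $\beta:G\times Y\to Y$, a conull Borel set $X_0\subseteq X$ and a measure-preserving Borel injection $\Phi:X_0\to Y$ (that is, $\Phi_*(\lambda|_{X_0})=\eta$) such that for every $g\in G$, for almost every $x\in X_0$, one has $\alpha(g,x)\in X_0$ and $\Phi(\alpha(g,x))=\beta(g,\Phi(x))$; (4) $X$ can be endowed with a locally compact Polish topology inducing its Borel structure such that $\lambda$ is Radon and there is a continuous $\lambda$-preserving action $\beta:G\times X\to X$ such that for every $g\in G$, $\beta(g,x)=\alpha(g,x)$ for almost every $x\in X$. -/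

import Mathlib

open MeasureTheory Filter Topology
open scoped ENNReal
universe u v

/-- A boolean measure-preserving action of `G` on `(X, μ)`: a Borel map `G × X → X` which
satisfies the action identity almost everywhere for each fixed pair of group elements, and each of
whose sections is a measure-preserving bijection of `(X, μ)`. -/
structure BooleanAction (G X : Type*) [Group G] [MeasurableSpace G] [MeasurableSpace X]
    (μ : Measure X) where
  /-- the underlying map `(g, x) ↦ α(g, x)` -/
  act : G → X → X
  measurable_act : Measurable (fun q : G × X => act q.1 q.2)
  act_mul_ae : ∀ g h : G, ∀ᵐ x ∂μ, act (g * h) x = act g (act h x)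
  bijective_act : ∀ g : G, Function.Bijective (act g)
  measurePreserving_act : ∀ g : G, MeasurePreserving (act g) μ μ

namespace BooleanAction

variable {G X Y : Type*} [Group G] [MeasurableSpace G] [MeasurableSpace X] [MeasurableSpace Y]
  {μ : Measure X} {η : Measure Y}

/-- The boolean action is a spatial one: the action identities hold everywhere. -/
def IsSpatial (α : BooleanAction G X μ) : Prop :=
  (∀ x : X, α.act 1 x = x) ∧ ∀ (g h : G) (x : X), α.act (g * h) x = α.act g (α.act h x)

/-- The spatial action is (jointly) continuous. -/
def IsContinuousSpatial [TopologicalSpace G] [TopologicalSpace X] (α : BooleanAction G X μ) :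
    Prop :=
  α.IsSpatial ∧ Continuous (fun q : G × X => α.act q.1 q.2)

/-- The element `f ∘ α(g⁻¹, ·)` of `L^∞(X, μ)`. -/
noncomputable def translate (α : BooleanAction G X μ) (g : G) (f : Lp ℂ ∞ μ) : Lp ℂ ∞ μ :=
  Lp.compMeasurePreserving (α.act g⁻¹) (α.measurePreserving_act g⁻¹) f

/-- The set of `G`-continuous functions: those `f ∈ L^∞(X, μ)` such that
`‖f - f ∘ α(g⁻¹, ·)‖_∞ → 0` as `g → 1`. -/
def gContinuous [TopologicalSpace G] (α : BooleanAction G X μ) : Set (Lp ℂ ∞ μ) :=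
  {f | Tendsto (fun g : G => ‖f - α.translate g f‖) (𝓝 1) (𝓝 0)}

/-- The intersection of the set of `G`-continuous functions with `L^p(X, μ)`, taken inside the
space of all measurable functions up to almost everywhere equality, as a subset of `L^p(X, μ)`. -/
def gContinuousInter [TopologicalSpace G] (α : BooleanAction G X μ) (p : ℝ≥0∞) :
    Set (Lp ℂ p μ) :=
  {h | ∃ f ∈ α.gContinuous, (f : X →ₘ[μ] ℂ) = (h : X →ₘ[μ] ℂ)}

/-- Two boolean actions are booleanly isomorphic: there is a measure-preserving Borel injection
`Φ : X₀ → Y`, defined on a conull Borel set `X₀ ⊆ X`, such that for every `g` the identity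
`Φ(α(g, x)) = β(g, Φ(x))` holds (and its left-hand side is defined) for almost every `x ∈ X₀`. -/
def BooleanlyIsomorphic (α : BooleanAction G X μ) (β : BooleanAction G Y η) : Prop :=
  ∃ (X₀ : Set X) (Φ : X₀ → Y), MeasurableSet X₀ ∧ μ X₀ᶜ = 0 ∧ Function.Injective Φ ∧
    MeasurePreserving Φ (μ.comap Subtype.val) η ∧
    ∀ g : G, ∀ᵐ x : X₀ ∂(μ.comap Subtype.val),
      ∃ hx : α.act g x ∈ X₀, Φ ⟨α.act g x, hx⟩ = β.act g (Φ x)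

end BooleanAction

/-- A boolean action admits a continuous Radon model: it is booleanly isomorphic to a continuous
measure-preserving action on a locally compact Polish space with a Radon measure.
`Measure.Regular` means: finite on compact sets, inner regular on open sets for compact sets, and
outer regular on Borel sets. -/
def BooleanAction.AdmitsContinuousRadonModel {G : Type v} {X : Type u} [Group G]
    [TopologicalSpace G] [MeasurableSpace G] [MeasurableSpace X] {μ : Measure X}
    (α : BooleanAction G X μ) : Prop :=
  ∃ (Y : Type u) (_ : TopologicalSpace Y) (_ : MeasurableSpace Y) (η : Measure Y)
    (β : BooleanAction G Y η),
    PolishSpace Y ∧ LocallyCompactSpace Y ∧ BorelSpace Y ∧ η.Regular ∧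
    β.IsContinuousSpatial ∧ α.BooleanlyIsomorphic β

/-- A boolean action on `(X, μ)` lifts to a continuous action on `X` itself: `X` carries a locally
compact Polish topology inducing its Borel structure, for which `μ` is Radon and for which there
is a continuous measure-preserving action whose sections agree with those of `α` up to null
sets. -/
def BooleanAction.LiftsToContinuousRadon {G X : Type*} [Group G]
    [TopologicalSpace G] [MeasurableSpace G] [MeasurableSpace X] {μ : Measure X}
    (α : BooleanAction G X μ) : Prop :=
  ∃ _ : TopologicalSpace X, PolishSpace X ∧ LocallyCompactSpace X ∧ BorelSpace X ∧ μ.Regular ∧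
    ∃ β : BooleanAction G X μ, β.IsContinuousSpatial ∧ ∀ g : G, β.act g =ᵐ[μ] α.act g

/-! A continuous model has many `G`-continuous functions: those of compact support are
`G`-continuous by compactness and dense in `L^p`, and both properties pull back to `X`.

Conversely, density yields countably many `G`-continuous `L^p` functions separating the points of a
conull set. Their translates by a countable dense `Γ ⊆ G` are the coordinates of a Borel map `Φ`
into a compact `K`, the support of the push-forward. Full support embeds `C(K)` isometrically in
`L^∞`, with closed range. Orbit maps of `G`-continuous functions are norm-continuous, so all
translates, not only those by `Γ`, come from `C(K)`, continuously in `g`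
(`exists_continuous_translates`). They define a continuous action on `K`; identities known almost
everywhere become exact by full support. Removing the zero sequence, which the action fixes, leaves
a locally compact space on which the push-forward is locally finite, by Chebyshev's inequality. Its
topology is carried to `X` by a Borel isomorphism equal to `Φ` almost everywhere
(`exists_measurableEquiv_ae_eq`). -/

/-! ### Measure theory on standard Borel spaces -/

/-- A finite atomless measure on `ℝ` admits an uncountable Borel null set. -/
theorem Real.exists_measurableSet_null_not_countable (ν : Measure ℝ) [IsFiniteMeasure ν]
    [NullSingletonClass ν] : ∃ Z : Set ℝ, MeasurableSet Z ∧ ν Z = 0 ∧ ¬ Z.Countable := by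
  have hQ : ν (Set.range ((↑) : ℚ → ℝ)) = 0 := (Set.countable_range _).measure_zero ν
  have h (n : ℕ) : ∃ U, Set.range ((↑) : ℚ → ℝ) ⊆ U ∧ IsOpen U ∧ ν U < ((n : ℝ≥0∞) + 1)⁻¹ :=
    Set.exists_isOpen_lt_of_lt _ _ (by rw [hQ]; simp)
  choose U hQU hUo hU using h
  refine ⟨⋂ n, U n, .iInter fun n => (hUo n).measurableSet, ?_, fun hc => ?_⟩
  · refine le_antisymm (ge_of_tendsto' (x := atTop) (f := fun n : ℕ => ((n : ℝ≥0∞) + 1)⁻¹) ?_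
      fun n => (measure_mono (Set.iInter_subset _ n)).trans (hU n).le) (zero_le)
    have := (tendsto_add_atTop_iff_nat 1).2 ENNReal.tendsto_inv_nat_nhds_zero
    simpa using this
  -- Baire: were this dense Gδ set countable, its complement would be a dense Gδ set disjoint from
  -- it.
  · have hd : Dense (⋂ n, U n) :=
      Rat.denseRange_cast.mono (Set.subset_iInter hQU)
    have hG : IsGδ (⋂ n, U n) := .iInter fun n => (hUo n).isGδ
    have hd' : Dense (⋂ n, U n)ᶜ := hc.dense_compl ℝ
    obtain ⟨x, hx, hx'⟩ := (hd.inter_of_Gδ hG hc.isGδ_compl hd').nonempty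
    exact hx' hx

section
variable {X Y : Type*} [MeasurableSpace X] [StandardBorelSpace X] [MeasurableSpace Y]
  {μ : Measure X}

/-- A set of positive measure for an atomless measure contains an uncountable Borel null set. -/
theorem MeasureTheory.exists_subset_null_not_countable [SFinite μ] [NullSingletonClass μ]
    {s : Set X} (hs : MeasurableSet s) (hμs : μ s ≠ 0) :
    ∃ N ⊆ s, MeasurableSet N ∧ μ N = 0 ∧ ¬ N.Countable := by
  have : StandardBorelSpace s := hs.standardBorel
  have hunc : ¬ Countable s := fun h => hμs (Set.Countable.measure_zero (Set.countable_coe_iff.1 h) μ)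
  let e : s ≃ᵐ ℝ := PolishSpace.measurableEquivOfNotCountable hunc
    (by rw [← Set.countable_univ_iff]; exact Cardinal.not_countable_real)
  let j : ℝ → X := fun t => (e.symm t : X)
  have hj : MeasurableEmbedding j :=
    (MeasurableEmbedding.subtype_coe hs).comp e.symm.measurableEmbedding
  -- `μ.toFinite` is finite and has the same null sets as `μ`.
  let ν : Measure ℝ := μ.toFinite.comap j
  have hν (A : Set ℝ) : ν A = μ.toFinite (j '' A) := hj.comap_apply _ _
  have : IsFiniteMeasure ν := ⟨by rw [hν]; exact measure_lt_top _ _⟩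
  have : NullSingletonClass ν := ⟨fun x => by
    rw [hν, Set.image_singleton, toFinite_apply_eq_zero_iff]; exact measure_singleton _⟩
  obtain ⟨Z, hZ, hZ0, hZc⟩ := Real.exists_measurableSet_null_not_countable ν
  refine ⟨j '' Z, ?_, hj.measurableSet_image.2 hZ, ?_, ?_⟩
  · rintro _ ⟨t, -, rfl⟩
    exact (e.symm t).2
  · rwa [hν, toFinite_apply_eq_zero_iff] at hZ0
  · exact fun h => hZc (Set.countable_of_injective_of_countable_image hj.injective.injOn h)

/-- A Borel map which is injective on a conull set agrees almost everywhere with a Borel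
isomorphism, provided that the measure is atomless. -/
theorem MeasureTheory.exists_measurableEquiv_ae_eq [StandardBorelSpace Y] [SFinite μ]
    [NullSingletonClass μ] (hμ : μ ≠ 0) {Φ : X → Y} (hΦ : Measurable Φ) {s : Set X}
    (hs : MeasurableSet s) (hsc : μ sᶜ = 0) (hinj : Set.InjOn Φ s) :
    ∃ e : X ≃ᵐ Y, e =ᵐ[μ] Φ := by
  classical
  have hμs : μ s ≠ 0 := fun h => hμ (Measure.measure_univ_eq_zero.1 (by
    rw [← Set.union_compl_self s]; exact measure_union_null h hsc))
  -- Giving up `N` makes the complements of the domain and of the range uncountable (they contain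
  -- `N` and `Φ '' N`), hence Borel isomorphic.
  obtain ⟨N, hNs, hN, hN0, hNc⟩ := exists_subset_null_not_countable hs hμs
  let t : Set X := s \ N
  have ht : MeasurableSet t := hs.diff hN
  have htinj : Set.InjOn Φ t := hinj.mono Set.sdiff_subset
  have := ht.standardBorel
  have hemb : MeasurableEmbedding (t.domRestrict Φ) :=
    (hΦ.comp measurable_subtype_coe).measurableEmbedding (Set.injOn_iff_injective.1 htinj)
  have hR : MeasurableSet (Set.range (t.domRestrict Φ)) := hemb.measurableSet_range
  have htc : μ tᶜ = 0 := by
    have : tᶜ = sᶜ ∪ N := by ext x; simp [t]; tauto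
    rw [this]
    exact measure_union_null hsc hN0
  have hc₁ : ¬ Countable (tᶜ : Set X) := fun h => hNc
    ((Set.countable_coe_iff.1 h).mono fun x hx => by simp [t, hx])
  have hc₂ : ¬ Countable ((Set.range (t.domRestrict Φ))ᶜ : Set Y) := fun h => hNc
    (Set.countable_of_injective_of_countable_image (hinj.mono hNs)
      ((Set.countable_coe_iff.1 h).mono (by
        rintro _ ⟨x, hx, rfl⟩ ⟨y, hyx⟩
        exact y.2.2 (hinj y.2.1 (hNs hx) hyx ▸ hx))))
  have := ht.compl.standardBorel
  have := hR.compl.standardBorel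
  refine ⟨(MeasurableEquiv.sumCompl ht).symm.trans ((MeasurableEquiv.sumCongr hemb.equivRange
    (PolishSpace.measurableEquivOfNotCountable hc₁ hc₂)).trans (MeasurableEquiv.sumCompl hR)), ?_⟩
  have hae : ∀ᵐ x ∂μ, x ∈ t := htc
  filter_upwards [hae] with x hx
  have h1 : (MeasurableEquiv.sumCompl ht).symm x = Sum.inl ⟨x, hx⟩ := by
    rw [MeasurableEquiv.symm_apply_eq]; rfl
  simp only [MeasurableEquiv.trans_apply, h1]
  change ((hemb.equivRange ⟨x, hx⟩ : Set.range (t.domRestrict Φ)) : Y) = Φ x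
  rw [hemb.equivRange_apply]
  rfl

/-- On a `σ`-finite standard Borel space there is an injective, nowhere vanishing function in
`L^p`. -/
theorem MeasureTheory.exists_injective_ne_zero_memLp [SigmaFinite μ] {p : ℝ≥0∞} (hp0 : p ≠ 0)
    (hp : p ≠ ∞) :
    ∃ f : X → ℂ, Function.Injective f ∧ (∀ x, f x ≠ 0) ∧ MemLp f p μ := by
  obtain ⟨w, hw0, hwm, hw⟩ := exists_pos_lintegral_lt_of_sigmaFinite μ (ε := 1) one_ne_zero
  let r : X → ℝ := fun x => (w x : ℝ) ^ (p.toReal⁻¹)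
  have hr0 (x : X) : 0 < r x := Real.rpow_pos_of_pos (hw0 x) _
  have hrm : Measurable r := by fun_prop
  have hr : MemLp r p μ := by
    refine ⟨hrm.aestronglyMeasurable, (eLpNorm_lt_top_iff_lintegral_rpow_enorm_lt_top hp0 hp).2 ?_⟩
    refine lt_of_eq_of_lt (lintegral_congr fun x => ?_) (hw.trans ENNReal.one_lt_top)
    have hpp : p.toReal ≠ 0 := (ENNReal.toReal_pos hp0 hp).ne'
    rw [Real.enorm_eq_ofReal (hr0 x).le, ENNReal.ofReal_rpow_of_pos (hr0 x)]
    simp only [r]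
    rw [← Real.rpow_mul (w x).coe_nonneg, inv_mul_cancel₀ hpp, Real.rpow_one, ENNReal.ofReal_coe_nnreal]
  let v : X → ℝ := fun x => Real.arctan (embeddingReal X x)
  have hvm : Measurable v :=
    Real.measurable_arctan.comp (measurableEmbedding_embeddingReal X).measurable
  have hvi : Function.Injective v :=
    Real.arctan_injective.comp (measurableEmbedding_embeddingReal X).injective
  -- The real part gives back `r`, then the imaginary part gives back the injective `v`; as `|v| ≤
  -- 2`, the norm is at most `3 * r`.
  refine ⟨fun x => ⟨r x, r x * v x⟩, fun x y hxy => ?_, fun x hx => ?_, ?_⟩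
  · obtain ⟨h1, h2⟩ := Complex.ext_iff.1 hxy
    simp only at h1 h2
    rw [h1] at h2
    exact hvi (mul_left_cancel₀ (hr0 y).ne' h2)
  · exact (hr0 x).ne' (congrArg Complex.re hx)
  · refine MemLp.of_le_mul (c := 3) hr (Measurable.aestronglyMeasurable ?_) (ae_of_all _ fun x => ?_)
    · have : Measurable fun x => Complex.equivRealProd.symm (r x, r x * v x) :=
        Complex.measurableEquivRealProd.symm.measurable.comp (hrm.prodMk (hrm.mul hvm))
      exact this
    · have h1 := Complex.norm_le_abs_re_add_abs_im (⟨r x, r x * v x⟩ : ℂ)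
      have h2 : |v x| ≤ 2 := abs_le.2
        ⟨by linarith [Real.neg_pi_div_two_lt_arctan (embeddingReal X x), Real.pi_le_four],
          by linarith [Real.arctan_lt_pi_div_two (embeddingReal X x), Real.pi_le_four]⟩
      simp only [abs_mul, abs_of_pos (hr0 x)] at h1
      rw [Real.norm_of_nonneg (hr0 x).le]
      nlinarith [hr0 x]

end

/-! ### Transport of a topology to `X` -/

namespace BooleanAction

variable {G X : Type*} [Group G] [MeasurableSpace G] [MeasurableSpace X] {μ : Measure X}

theorem act_one_ae (α : BooleanAction G X μ) : ∀ᵐ x ∂μ, α.act 1 x = x := by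
  filter_upwards [α.act_mul_ae 1 1] with x hx
  rw [mul_one] at hx
  exact ((α.bijective_act 1).1 hx).symm

/-- A boolean action which factors, through an almost everywhere injective Borel map, onto a
continuous action on a locally compact Polish space lifts to a continuous Radon action as soon as
points of this space have neighbourhoods of finite measure. -/
theorem liftsToContinuousRadon_of_continuousSMul [TopologicalSpace G] [PolishSpace G]
    [BorelSpace G] [StandardBorelSpace X] [SFinite μ] [NullSingletonClass μ] (hμ : μ ≠ 0)
    (α : BooleanAction G X μ) {Y : Type*} [TopologicalSpace Y] [PolishSpace Y]
    [LocallyCompactSpace Y] [MulAction G Y] [ContinuousSMul G Y]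
    [MeasurableSpace Y] [BorelSpace Y] {Φ : X → Y} (hΦ : Measurable Φ)
    {s : Set X} (hs : MeasurableSet s) (hsc : μ sᶜ = 0) (hinj : Set.InjOn Φ s)
    (hfin : ∀ y : Y, ∃ U ∈ 𝓝 y, μ (Φ ⁻¹' U) < ∞)
    (hequi : ∀ g : G, ∀ᵐ x ∂μ, Φ (α.act g x) = g • Φ x) :
    α.LiftsToContinuousRadon := by
  obtain ⟨e, he⟩ := exists_measurableEquiv_ae_eq hμ hΦ hs hsc hinj
  let τ : TopologicalSpace X := .induced e inferInstance
  let h : X ≃ₜ Y := e.toEquiv.toHomeomorphOfIsInducing ⟨rfl⟩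
  have hh (x : X) : h x = e x := rfl
  have : PolishSpace X := h.isClosedEmbedding.polishSpace
  have : LocallyCompactSpace X := h.isClosedEmbedding.locallyCompactSpace
  have : BorelSpace X :=
    ⟨e.measurableEmbedding.comap_eq.symm.trans ((congrArg (MeasurableSpace.comap h)
      (BorelSpace.measurable_eq (α := Y))).trans borel_comap.symm)⟩
  -- On a locally compact Polish space, local finiteness already gives regularity.
  have : IsLocallyFiniteMeasure μ := by
    constructor
    intro x
    obtain ⟨U, hU, hUf⟩ := hfin (h x)
    refine ⟨h ⁻¹' U, h.continuous.continuousAt hU, lt_of_eq_of_lt (measure_congr ?_) hUf⟩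
    filter_upwards [he] with x hx
    exact congrArg U (hh x ▸ hx)
  have hβ (g : G) : (fun x => h.symm (g • h x)) =ᵐ[μ] α.act g := by
    filter_upwards [he, (α.measurePreserving_act g).quasiMeasurePreserving.ae he, hequi g]
      with x h1 h2 h3
    rw [h.symm_apply_eq, hh, hh, h1, h2, h3]
  have hcont : Continuous fun q : G × X => h.symm (q.1 • h q.2) := by fun_prop
  let β : BooleanAction G X μ :=
    { act := fun g x => h.symm (g • h x)
      measurable_act := hcont.measurable
      act_mul_ae := fun g k => ae_of_all _ fun x => by simp [mul_smul]
      bijective_act := fun g =>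
        h.symm.bijective.comp ((MulAction.bijective g).comp h.bijective)
      measurePreserving_act := fun g =>
        ⟨(hcont.comp (Continuous.prodMk_right g)).measurable, by
          rw [Measure.map_congr (hβ g)]
          exact (α.measurePreserving_act g).map_eq⟩ }
  exact ⟨τ, inferInstance, inferInstance, inferInstance, inferInstance, β,
    ⟨⟨fun x => by simp [β], fun g k x => by simp [β, mul_smul]⟩, hcont⟩, hβ⟩

end BooleanAction

/-! ### Compact models with full support -/

section
variable {X K : Type*} [MeasurableSpace X] {μ : Measure X}

theorem MeasureTheory.Lp.ae_norm_le_norm_top (f : Lp ℂ ∞ μ) : ∀ᵐ x ∂μ, ‖f x‖ ≤ ‖f‖ := by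
  have h : eLpNorm f ∞ μ ≠ ∞ := (Lp.memLp f).eLpNorm_ne_top
  filter_upwards [ae_le_eLpNormEssSup (f := f) (μ := μ)] with x hx
  rw [Lp.norm_def, ← toReal_enorm]
  exact ENNReal.toReal_mono h (by rwa [eLpNorm_exponent_top])

theorem MeasureTheory.Lp.norm_le_of_ae_norm_le_top (f : Lp ℂ ∞ μ) {c : ℝ} (hc : 0 ≤ c)
    (h : ∀ᵐ x ∂μ, ‖f x‖ ≤ c) : ‖f‖ ≤ c := by
  rw [Lp.norm_def, eLpNorm_exponent_top]
  exact ENNReal.toReal_le_of_le_ofReal hc (eLpNormEssSup_le_of_ae_bound h)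

/-- Countably many essentially bounded Borel functions are, up to a null set, the coordinates of
a Borel map into a compact set of sequences on which the push-forward measure has full support. -/
theorem MeasureTheory.exists_isCompact_measurable_coord {I : Type*} [Countable I] (hμ : μ ≠ 0)
    {f : I → X → ℂ} (hf : ∀ i, Measurable (f i)) {c : I → ℝ}
    (hc : ∀ i, ∀ᵐ x ∂μ, ‖f i x‖ ≤ c i) :
    ∃ (K : Set (I → ℂ)) (Φ : X → K), IsCompact K ∧ Measurable Φ ∧
      (∀ᵐ x ∂μ, ∀ i, (Φ x : I → ℂ) i = f i x) ∧
      ∀ C : Set K, IsClosed C → (∀ᵐ x ∂μ, Φ x ∈ C) → C = Set.univ := by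
  classical
  let F : X → I → ℂ := fun x i => f i x
  have hF : Measurable F := measurable_pi_lambda _ hf
  let ν : Measure (I → ℂ) := μ.map F
  have hν : ν ≠ 0 := (Measure.map_ne_zero_iff hF.aemeasurable).2 hμ
  have hmap (A : Set (I → ℂ)) (hA : MeasurableSet A) : A ∈ ae ν ↔ ∀ᵐ x ∂μ, F x ∈ A :=
    ae_map_iff hF.aemeasurable hA
  have hFK : ∀ᵐ x ∂μ, F x ∈ ν.support :=
    (hmap _ Measure.isClosed_support.measurableSet).1 Measure.support_mem_ae
  obtain ⟨k₀, hk₀⟩ := Measure.nonempty_support hν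
  have hcpt : IsCompact ν.support := by
    refine (isCompact_univ_pi fun i => isCompact_closedBall (0 : ℂ) (c i)).of_isClosed_subset
      Measure.isClosed_support (Measure.support_subset_of_isClosed
        (isClosed_set_pi fun i _ => Metric.isClosed_closedBall) ?_)
    rw [hmap _ (isClosed_set_pi fun i _ => Metric.isClosed_closedBall).measurableSet]
    filter_upwards [ae_all_iff.2 hc] with x hx i _
    simpa using hx i
  -- The default `k₀` is used only on a null set.
  let Φ : X → ν.support := fun x => if h : F x ∈ ν.support then ⟨F x, h⟩ else ⟨k₀, hk₀⟩
  have hΦ : ∀ᵐ x ∂μ, (Φ x : I → ℂ) = F x := by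
    filter_upwards [hFK] with x hx
    simp [Φ, hx]
  refine ⟨ν.support, Φ, hcpt, ?_, ?_, fun C hC hCae => ?_⟩
  · exact Measurable.dite (s := {x | F x ∈ ν.support})
      (f := fun x => (⟨F x, x.2⟩ : ν.support)) (g := fun _ => ⟨k₀, hk₀⟩)
      ((hF.comp measurable_subtype_coe).subtype_mk) measurable_const
      (hF Measure.isClosed_support.measurableSet)
  · filter_upwards [hΦ] with x hx i
    rw [hx]
  · have hcl : IsClosed (Subtype.val '' C) :=
      Measure.isClosed_support.isClosedEmbedding_subtypeVal.isClosedMap C hC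
    have hsub : ν.support ⊆ Subtype.val '' C := by
      refine Measure.support_subset_of_isClosed hcl ((hmap _ hcl.measurableSet).2 ?_)
      filter_upwards [hΦ, hCae] with x h1 h2
      exact ⟨Φ x, h2, h1⟩
    refine Set.eq_univ_of_forall fun k => ?_
    obtain ⟨k', hk', h⟩ := hsub k.2
    rwa [← Subtype.ext h]

/-- The equalizer is closed and conull, so full support makes it everything. This turns
almost-everywhere identities into exact ones. -/
theorem MeasureTheory.eq_of_ae_eq_comp {Z : Type*} [TopologicalSpace K] [TopologicalSpace Z]
    [T2Space Z] {Φ : X → K} (hfull : ∀ C : Set K, IsClosed C → (∀ᵐ x ∂μ, Φ x ∈ C) → C = Set.univ)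
    {a b : K → Z} (ha : Continuous a) (hb : Continuous b) (hab : ∀ᵐ x ∂μ, a (Φ x) = b (Φ x))
    (y : K) : a y = b y :=
  (hfull {y | a y = b y} (isClosed_eq ha hb) hab).ge (Set.mem_univ y)

variable [TopologicalSpace K] [CompactSpace K] [MeasurableSpace K] [OpensMeasurableSpace K]

theorem ContinuousMap.memLp_top_comp {Φ : X → K} (hΦ : Measurable Φ) (F : C(K, ℂ)) :
    MemLp (F ∘ Φ) ∞ μ :=
  memLp_top_of_bound (F.continuous.measurable.comp hΦ).aestronglyMeasurable ‖F‖
    (ae_of_all _ fun _ => F.norm_coe_le_norm _)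

/-- The pull-back homomorphism `C(K) → L^∞(X, μ)` along a Borel map `X → K`. -/
noncomputable def ContinuousMap.pullbackLpTop (μ : Measure X) {Φ : X → K} (hΦ : Measurable Φ) :
    C(K, ℂ) →+ Lp ℂ ∞ μ where
  toFun F := (F.memLp_top_comp hΦ).toLp
  map_zero' := MemLp.toLp_zero ((0 : C(K, ℂ)).memLp_top_comp hΦ)
  map_add' F F' := MemLp.toLp_add (F.memLp_top_comp hΦ) (F'.memLp_top_comp hΦ)

theorem ContinuousMap.coeFn_pullbackLpTop {Φ : X → K} (hΦ : Measurable Φ) (F : C(K, ℂ)) :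
    ContinuousMap.pullbackLpTop μ hΦ F =ᵐ[μ] F ∘ Φ :=
  MemLp.coeFn_toLp (F.memLp_top_comp hΦ)

/-- An essential bound on `F ∘ Φ` holds for `F` on a closed conull set, hence everywhere by full
support. -/
theorem ContinuousMap.isometry_pullbackLpTop {Φ : X → K} (hΦ : Measurable Φ)
    (hfull : ∀ C : Set K, IsClosed C → (∀ᵐ x ∂μ, Φ x ∈ C) → C = Set.univ) :
    Isometry (ContinuousMap.pullbackLpTop μ hΦ) := by
  refine AddMonoidHomClass.isometry_of_norm _ fun F => le_antisymm ?_ ?_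
  · refine Lp.norm_le_of_ae_norm_le_top _ (norm_nonneg _) ?_
    filter_upwards [F.coeFn_pullbackLpTop hΦ] with x hx
    rw [hx]
    exact F.norm_coe_le_norm _
  · refine (F.norm_le (norm_nonneg _)).2 fun k => ?_
    have := hfull {k | ‖F k‖ ≤ ‖ContinuousMap.pullbackLpTop μ hΦ F‖}
      (isClosed_le (by fun_prop) continuous_const) (by
        filter_upwards [F.coeFn_pullbackLpTop hΦ,
          Lp.ae_norm_le_norm_top (ContinuousMap.pullbackLpTop μ hΦ F)] with x h1 h2
        rwa [h1] at h2)
    exact this.ge (Set.mem_univ k)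

end

/-! ### Translates of `G`-continuous functions -/

namespace BooleanAction

variable {G X : Type*} [Group G] [MeasurableSpace G] [MeasurableSpace X] {μ : Measure X}

theorem compMeasurePreserving_mul (α : BooleanAction G X μ) (f : Lp ℂ ∞ μ) (g h : G) :
    Lp.compMeasurePreserving (α.act (g * h)) (α.measurePreserving_act (g * h)) f =
      Lp.compMeasurePreserving (α.act h) (α.measurePreserving_act h)
        (Lp.compMeasurePreserving (α.act g) (α.measurePreserving_act g) f) := by
  apply Lp.ext
  filter_upwards [Lp.coeFn_compMeasurePreserving f (α.measurePreserving_act (g * h)),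
    Lp.coeFn_compMeasurePreserving (Lp.compMeasurePreserving (α.act g)
      (α.measurePreserving_act g) f) (α.measurePreserving_act h),
    (α.measurePreserving_act h).quasiMeasurePreserving.ae
      (Lp.coeFn_compMeasurePreserving f (α.measurePreserving_act g)), α.act_mul_ae g h]
    with x h1 h2 h3 h4
  rw [h1, h2, Function.comp_apply, Function.comp_apply, h3, h4, Function.comp_apply]

theorem compMeasurePreserving_one (α : BooleanAction G X μ) (f : Lp ℂ ∞ μ) :
    Lp.compMeasurePreserving (α.act 1) (α.measurePreserving_act 1) f = f := by
  apply Lp.ext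
  filter_upwards [Lp.coeFn_compMeasurePreserving f (α.measurePreserving_act 1), α.act_one_ae]
    with x h1 h2
  rw [h1, Function.comp_apply, h2]

variable [TopologicalSpace G] [IsTopologicalGroup G]

/-- The orbit map of a `G`-continuous function is norm-continuous. -/
theorem continuous_compMeasurePreserving (α : BooleanAction G X μ) {f : Lp ℂ ∞ μ}
    (hf : f ∈ α.gContinuous) :
    Continuous fun g : G => Lp.compMeasurePreserving (α.act g) (α.measurePreserving_act g) f := by
  -- Composition with `α.act h` is isometric, which moves continuity at `h` to continuity at `1`;
  -- the inverse in `translate` explains `h * g⁻¹`.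
  refine continuous_iff_continuousAt.2 fun h => tendsto_iff_norm_sub_tendsto_zero.2 ?_
  have hlim : Tendsto (fun g : G => h * g⁻¹) (𝓝 h) (𝓝 1) := by
    have : Continuous fun g : G => h * g⁻¹ := by fun_prop
    simpa using this.tendsto h
  refine (hf.comp hlim).congr fun g => ?_
  have h1 := α.compMeasurePreserving_mul f (g * h⁻¹) h
  have h2 := α.compMeasurePreserving_mul f 1 h
  simp only [inv_mul_cancel_right, one_mul, compMeasurePreserving_one] at h1 h2
  rw [h1, ← map_sub, Lp.norm_compMeasurePreserving, norm_sub_rev]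
  simp [translate]

/-- If the translates of a `G`-continuous function by a dense set of group elements are given by
continuous functions on a compact model, then so are all of its translates, and these depend
continuously on the group element. -/
theorem exists_continuous_translates (α : BooleanAction G X μ) {f : Lp ℂ ∞ μ}
    (hf : f ∈ α.gContinuous) {K : Type*} [TopologicalSpace K] [CompactSpace K]
    [MeasurableSpace K] [OpensMeasurableSpace K] {Φ : X → K} (hΦ : Measurable Φ)
    (hfull : ∀ C : Set K, IsClosed C → (∀ᵐ x ∂μ, Φ x ∈ C) → C = Set.univ)
    {Γ : Set G} (hΓ : Dense Γ)
    (hcoord : ∀ g ∈ Γ, ∃ F : C(K, ℂ), ∀ᵐ x ∂μ, F (Φ x) = f (α.act g x)) :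
    ∃ E : G → C(K, ℂ), Continuous E ∧ ∀ g, ∀ᵐ x ∂μ, E g (Φ x) = f (α.act g x) := by
  let J := ContinuousMap.pullbackLpTop μ hΦ
  let u : G → Lp ℂ ∞ μ := fun g =>
    Lp.compMeasurePreserving (α.act g) (α.measurePreserving_act g) f
  have hu : Continuous u := α.continuous_compMeasurePreserving hf
  have hJ : IsClosedEmbedding J := (ContinuousMap.isometry_pullbackLpTop hΦ hfull).isClosedEmbedding
  -- The range of an isometry from a complete space is closed, so membership passes from `Γ` to its
  -- closure.
  have hmem (g : G) : u g ∈ Set.range J := by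
    refine hΓ.induction (P := fun g => u g ∈ Set.range J) (fun g hg => ?_)
      (hJ.isClosed_range.preimage hu) g
    obtain ⟨F, hF⟩ := hcoord g hg
    refine ⟨F, Lp.ext ?_⟩
    filter_upwards [F.coeFn_pullbackLpTop hΦ, hF,
      Lp.coeFn_compMeasurePreserving f (α.measurePreserving_act g)] with x h1 h2 h3
    rw [h1, h3, Function.comp_apply, Function.comp_apply, h2]
  choose E hE using hmem
  refine ⟨E, hJ.isInducing.continuous_iff.2 ?_, fun g => ?_⟩
  · convert hu
    exact funext hE
  · filter_upwards [(E g).coeFn_pullbackLpTop (μ := μ) hΦ,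
      Lp.coeFn_compMeasurePreserving f (α.measurePreserving_act g)] with x h1 h2
    have h3 : J (E g) x = u g x := by rw [hE]
    rw [← Function.comp_apply (f := E g), ← h1, ← Function.comp_apply (f := f), ← h2]
    exact h3

end BooleanAction

/-! ### From density to a continuous action -/

namespace BooleanAction

variable {G X : Type*} [Group G] [MeasurableSpace G] [MeasurableSpace X] {μ : Measure X}
  [TopologicalSpace G]

/-- If `G`-continuous functions are dense in `L^p`, there are countably many of them whose values
separate the points of a conull set, and all of them from zero. -/
theorem exists_countable_separating_gContinuous [StandardBorelSpace X] [SigmaFinite μ]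
    (α : BooleanAction G X μ) {p : ℝ≥0∞} [Fact (1 ≤ p)] (hp : p ≠ ∞)
    (hd : Dense (α.gContinuousInter p)) :
    ∃ S : Set (Lp ℂ ∞ μ), S.Countable ∧ S ⊆ α.gContinuous ∧ (∀ f ∈ S, MemLp f p μ) ∧
      ∃ s : Set X, μ sᶜ = 0 ∧ (∀ x ∈ s, ∃ f ∈ S, f x ≠ 0) ∧
        ∀ x ∈ s, ∀ y ∈ s, (∀ f ∈ S, f x = f y) → x = y := by
  have hp0 : p ≠ 0 := (zero_lt_one.trans_le (Fact.out : 1 ≤ p)).ne'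
  -- One injective, nowhere zero `u` suffices: an almost everywhere convergent sequence of
  -- approximants inherits separation from its limit.
  obtain ⟨u, hui, hu0, hu⟩ := exists_injective_ne_zero_memLp (μ := μ) hp0 hp
  obtain ⟨a, ha, hlim⟩ := mem_closure_iff_seq_limit.1 (hd.closure_eq.ge (Set.mem_univ hu.toLp))
  obtain ⟨n, -, hn⟩ := (tendstoInMeasure_of_tendsto_Lp hlim).exists_seq_tendsto_ae
  choose f hf hfa using ha
  have hfa' (k : ℕ) : f k =ᵐ[μ] a k := by
    have : ((f k : X →ₘ[μ] ℂ) : X → ℂ) = ((a k : X →ₘ[μ] ℂ) : X → ℂ) := by rw [hfa k]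
    exact this.eventuallyEq
  have hae : ∀ᵐ x ∂μ, Tendsto (fun k => f (n k) x) atTop (𝓝 (u x)) := by
    filter_upwards [hn, hu.coeFn_toLp, ae_all_iff.2 hfa'] with x h1 h2 h3
    rw [h2] at h1
    exact h1.congr fun k => (h3 _).symm
  refine ⟨Set.range f, Set.countable_range f, Set.range_subset_iff.2 hf, ?_,
    {x | Tendsto (fun k => f (n k) x) atTop (𝓝 (u x))}, hae, fun x hx => ?_,
    fun x hx y hy h => hui ?_⟩
  · rintro _ ⟨k, rfl⟩
    exact (Lp.memLp (a k)).ae_eq (hfa' k).symm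
  · by_contra! h
    refine hu0 x (tendsto_nhds_unique hx ?_)
    simp [h _ (Set.mem_range_self _)]
  · exact tendsto_nhds_unique hx (hy.congr fun k => (h _ (Set.mem_range_self _)).symm)

/-- If the `G`-continuous functions are dense in some `L^p` with `p < ∞`, then the boolean action
lifts to a continuous Radon action. -/
theorem liftsToContinuousRadon_of_dense [IsTopologicalGroup G] [PolishSpace G] [BorelSpace G]
    [StandardBorelSpace X] [SigmaFinite μ] [NullSingletonClass μ] (hμ : μ ≠ 0)
    (α : BooleanAction G X μ) {p : ℝ≥0∞} [Fact (1 ≤ p)] (hp : p ≠ ∞)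
    (hd : Dense (α.gContinuousInter p)) : α.LiftsToContinuousRadon := by
  classical
  have hp0 : p ≠ 0 := (zero_lt_one.trans_le (Fact.out : 1 ≤ p)).ne'
  obtain ⟨S, hSc, hS, hSp, s, hsc, hs0, hsep⟩ := α.exists_countable_separating_gContinuous hp hd
  obtain ⟨Γ₀, hΓ₀c, hΓ₀⟩ := TopologicalSpace.exists_countable_dense G
  -- With `1 ∈ Γ`, the functions of `S` are themselves among the coordinates.
  let Γ : Set G := insert 1 Γ₀
  have hΓc : Γ.Countable := hΓ₀c.insert 1
  have hΓ : Dense Γ := hΓ₀.mono (Set.subset_insert _ _)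
  have : Countable S := hSc
  have : Countable Γ := hΓc
  have hqmp (g : G) := (α.measurePreserving_act g).quasiMeasurePreserving
  have hactm (g : G) : Measurable (α.act g) := (α.measurePreserving_act g).measurable
  obtain ⟨K, Φ, hK, hΦ, hcoord, hfull⟩ := exists_isCompact_measurable_coord (I := S × Γ) hμ
    (f := fun i x => (i.1 : Lp ℂ ∞ μ) (α.act i.2 x)) (c := fun i => ‖(i.1 : Lp ℂ ∞ μ)‖)
    (fun i => (Lp.stronglyMeasurable _).measurable.comp (hactm _))
    (fun i => (hqmp _).ae (Lp.ae_norm_le_norm_top _))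
  have : CompactSpace K := isCompact_iff_compactSpace.1 hK
  let coord (i : S × Γ) : C(K, ℂ) := ⟨fun y => y.1 i, (continuous_apply i).comp continuous_subtype_val⟩
  have hE (f : S) := α.exists_continuous_translates (hS f.2) hΦ hfull hΓ
    (fun g hg => ⟨coord (f, ⟨g, hg⟩), by filter_upwards [hcoord] with x hx; exact hx _⟩)
  choose E hEc hE using hE
  have hEΓ (f : S) (γ : Γ) (y : K) : E f γ y = y.1 (f, γ) := by
    refine eq_of_ae_eq_comp hfull (E f γ).continuous (coord (f, γ)).continuous ?_ y
    filter_upwards [hE f γ, hcoord] with x h1 h2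
    rw [h1]
    exact (h2 (f, γ)).symm
  -- Forced by equivariance: coordinate `(f, γ)` of `Φ (g x)` is `f (γ g x)`, the translate of `f`
  -- by `γ * g`.
  let b : G → K → S × Γ → ℂ := fun g y i => E i.1 (i.2 * g) y
  have hbc : Continuous fun q : G × K => b q.1 q.2 := by
    refine continuous_pi fun i => ?_
    exact ((hEc i.1).comp (by fun_prop : Continuous fun q : G × K => (i.2 : G) * q.1)).eval
      continuous_snd
  have hbg (g : G) : Continuous (b g) := hbc.comp (Continuous.prodMk_right g)
  have hbΦ (g : G) : ∀ᵐ x ∂μ, b g (Φ x) = Φ (α.act g x) := by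
    have h (i : S × Γ) : ∀ᵐ x ∂μ, b g (Φ x) i = (Φ (α.act g x) : S × Γ → ℂ) i := by
      filter_upwards [hE i.1 (i.2 * g), α.act_mul_ae i.2 g, (hqmp g).ae hcoord] with x h1 h2 h3
      rw [h3 i, ← h2, ← h1]
    filter_upwards [ae_all_iff.2 h] with x hx
    exact funext hx
  have hbK (g : G) (y : K) : b g y ∈ K := by
    refine (hfull {y | b g y ∈ K} (hK.isClosed.preimage (hbg g)) ?_).ge (Set.mem_univ y)
    filter_upwards [hbΦ g] with x hx
    simp [hx]
  let actK : G → K → K := fun g y => ⟨b g y, hbK g y⟩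
  have hactKc : Continuous fun q : G × K => actK q.1 q.2 := hbc.subtype_mk _
  have hactKg (g : G) : Continuous (actK g) := hactKc.comp (Continuous.prodMk_right g)
  have hactΦ (g : G) : ∀ᵐ x ∂μ, actK g (Φ x) = Φ (α.act g x) := by
    filter_upwards [hbΦ g] with x hx
    exact Subtype.ext hx
  have hone (y : K) : actK 1 y = y := by
    refine eq_of_ae_eq_comp hfull (hactKg 1) continuous_id ?_ y
    filter_upwards [hactΦ 1, α.act_one_ae] with x h1 h2
    rw [h1, h2, id]
  have hmul (g h : G) (y : K) : actK (g * h) y = actK g (actK h y) := by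
    refine eq_of_ae_eq_comp hfull (hactKg _) ((hactKg g).comp (hactKg h)) ?_ y
    filter_upwards [hactΦ (g * h), hactΦ h, (hqmp h).ae (hactΦ g), α.act_mul_ae g h]
      with x h1 h2 h3 h4
    rw [h1, Function.comp_apply, h2, h3, h4]
  -- At the zero sequence `E f` vanishes on `Γ`, hence on all of `G` by continuity.
  have hzero (g : G) {y : K} (hy : y.1 = 0) : (actK g y).1 = 0 := by
    have h (f : S) (g : G) : E f g y = 0 := by
      refine hΓ.induction (P := fun g => E f g y = 0) (fun γ hγ => ?_)
        (isClosed_eq ((hEc f).eval continuous_const) continuous_const) g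
      rw [hEΓ f ⟨γ, hγ⟩ y, hy]
      rfl
    exact funext fun i => h _ _
  have hne (g : G) {y : K} (hy : y.1 ≠ 0) : (actK g y).1 ≠ 0 := fun h => hy (by
    have := hzero g⁻¹ h
    rwa [← hmul, inv_mul_cancel, hone] at this)
  let T : Set K := {y | y.1 ≠ 0}
  have hT : IsOpen T := isOpen_ne.preimage continuous_subtype_val
  have : PolishSpace K := hK.isClosed.polishSpace
  have : PolishSpace T := hT.polishSpace
  have : LocallyCompactSpace T := hT.locallyCompactSpace
  let _ : MulAction G T :=
    { smul := fun g y => ⟨actK g y.1, hne g y.2⟩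
      one_smul := fun y => Subtype.ext (hone y.1)
      mul_smul := fun g h y => Subtype.ext (hmul g h y.1) }
  have : ContinuousSMul G T := ⟨(hactKc.comp
    (continuous_fst.prodMk (continuous_subtype_val.comp continuous_snd))).subtype_mk _⟩
  -- on a conull set, the coordinates of `Φ x` determine `x` and do not all vanish
  have hS1 : ∀ᵐ x ∂μ, ∀ f : S, (Φ x).1 (f, ⟨1, Set.mem_insert _ _⟩) = (f : Lp ℂ ∞ μ) x := by
    filter_upwards [hcoord, α.act_one_ae] with x h1 h2 f
    rw [h1]
    simp only [h2]
  obtain ⟨R, hRsub, hRm, hRc⟩ : ∃ R : Set X, R ⊆ {x | x ∈ s ∧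
      ∀ f : S, (Φ x).1 (f, ⟨1, Set.mem_insert _ _⟩) = (f : Lp ℂ ∞ μ) x} ∧ MeasurableSet R ∧
      μ Rᶜ = 0 := by
    have hs' : ∀ᵐ x ∂μ, x ∈ s := hsc
    exact (hs'.and hS1).exists_measurable_mem.imp fun R h => ⟨h.2.2, h.2.1, h.1⟩
  have hRT (x : X) (hx : x ∈ R) : Φ x ∈ T := by
    obtain ⟨f, hf, hfx⟩ := hs0 x (hRsub hx).1
    intro h
    apply hfx
    rw [← (hRsub hx).2 ⟨f, hf⟩, h]
    rfl
  have hRae : ∀ᵐ x ∂μ, x ∈ R := hRc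
  have : NeBot (ae μ) := ae_neBot.2 hμ
  obtain ⟨x₀, hx₀⟩ := hRae.exists
  let Ψ : X → T := fun x => if h : Φ x ∈ T then ⟨Φ x, h⟩ else ⟨Φ x₀, hRT x₀ hx₀⟩
  have hΨm : Measurable Ψ := Measurable.dite (s := {x | Φ x ∈ T})
      (f := fun x => (⟨Φ x, x.2⟩ : T)) (g := fun _ => ⟨Φ x₀, hRT x₀ hx₀⟩)
      ((hΦ.comp measurable_subtype_coe).subtype_mk) measurable_const (hΦ hT.measurableSet)
  have hΨ (x : X) (hx : x ∈ R) : (Ψ x : K) = Φ x := by simp [Ψ, hRT x hx]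
  refine α.liftsToContinuousRadon_of_continuousSMul hμ hΨm hRm hRc (fun x hx y hy hxy => ?_)
    (fun y => ?_) (fun g => ?_)
  · have hxy' : Φ x = Φ y := by rw [← hΨ x hx, ← hΨ y hy, hxy]
    refine hsep x (hRsub hx).1 y (hRsub hy).1 fun f hf => ?_
    rw [← (hRsub hx).2 ⟨f, hf⟩, ← (hRsub hy).2 ⟨f, hf⟩, hxy']
  · obtain ⟨i, hi⟩ := Function.ne_iff.1 y.2
    have hpos : 0 < ‖y.1.1 i‖₊ := nnnorm_pos.2 hi
    -- Up to a null set, the preimage is where a translate of an `L^p` function exceeds a positive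
    -- threshold.
    refine ⟨{z : T | ‖y.1.1 i‖₊ / 2 < ‖z.1.1 i‖₊}, ?_, ?_⟩
    · refine (isOpen_lt continuous_const (continuous_nnnorm.comp ((continuous_apply i).comp
        (continuous_subtype_val.comp continuous_subtype_val)))).mem_nhds ?_
      exact NNReal.half_lt_self hpos.ne'
    · have hmem := (hSp i.1 i.1.2).comp_measurePreserving (α.measurePreserving_act i.2)
      refine lt_of_le_of_lt (measure_mono_ae ?_)
        (hmem.meas_ge_lt_top hp0 hp (ε := ‖y.1.1 i‖₊ / 2) (half_pos hpos).ne')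
      filter_upwards [hRae, hcoord] with x h1 h2 (h3 : ‖y.1.1 i‖₊ / 2 < ‖(Ψ x).1.1 i‖₊)
      rw [hΨ x h1, h2 i] at h3
      exact h3.le
  · filter_upwards [hRae, (hqmp g).ae hRae, hactΦ g] with x h1 h2 h3
    apply Subtype.ext
    rw [hΨ _ h2, ← h3, ← hΨ x h1]
    rfl

end BooleanAction

/-! ### From a continuous model to density -/

/-- For a continuous action, a compactly supported continuous function is uniformly close to its
translates by elements near the identity. -/
theorem HasCompactSupport.eventually_norm_sub_comp_le {G Y : Type*} [Group G]
    [TopologicalSpace G] [IsTopologicalGroup G] [TopologicalSpace Y] {a : G → Y → Y}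
    (ha : Continuous fun q : G × Y => a q.1 q.2) (hone : ∀ y, a 1 y = y)
    (hmul : ∀ g h y, a (g * h) y = a g (a h y)) {f : Y → ℂ} (hf : Continuous f)
    (hfc : HasCompactSupport f) {ε : ℝ} (hε : 0 < ε) :
    ∀ᶠ g in 𝓝 (1 : G), ∀ y, ‖f y - f (a g⁻¹ y)‖ ≤ ε := by
  have hcont : Continuous fun q : G × Y => ‖f q.2 - f (a q.1 q.2)‖ := by
    have := hf.comp ha
    exact ((hf.comp continuous_snd).sub this).norm
  have h : ∀ᶠ g in 𝓝 (1 : G), ∀ y ∈ tsupport f, ‖f y - f (a g y)‖ < ε :=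
    hfc.isCompact.eventually_forall_of_forall_eventually fun y _ =>
      hcont.continuousAt.eventually (isOpen_Iio.mem_nhds (by simpa [hone] using hε))
  have hinv : Tendsto (fun g : G => g⁻¹) (𝓝 1) (𝓝 1) := by
    simpa using (continuous_inv (G := G)).tendsto 1
  filter_upwards [h, hinv.eventually h] with g h1 h2 y
  by_cases hy : y ∈ tsupport f
  · exact (h2 y hy).le
  -- If only `a g⁻¹ y` lies in the support, the estimate for `g` at that point applies.
  by_cases hz : a g⁻¹ y ∈ tsupport f
  · have := h1 _ hz
    rw [← hmul, mul_inv_cancel, hone, norm_sub_rev] at this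
    exact this.le
  · rw [image_eq_zero_of_notMem_tsupport hy, image_eq_zero_of_notMem_tsupport hz]
    simpa using hε.le

namespace BooleanAction

variable {G X Y : Type*} [Group G] [MeasurableSpace G] [MeasurableSpace X] [MeasurableSpace Y]
  {μ : Measure X} {η : Measure Y}

theorem booleanlyIsomorphic_of_ae_eq {α β : BooleanAction G X μ}
    (h : ∀ g, β.act g =ᵐ[μ] α.act g) : α.BooleanlyIsomorphic β := by
  refine ⟨Set.univ, Subtype.val, .univ, by simp, Subtype.val_injective,
    ⟨measurable_subtype_coe, ?_⟩, fun g => ?_⟩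
  · rw [map_comap_subtype_coe .univ, Measure.restrict_univ]
  · have := (MeasurePreserving.mk (measurable_subtype_coe (p := (· ∈ Set.univ)))
      (by rw [map_comap_subtype_coe .univ, Measure.restrict_univ] :
        Measure.map _ (μ.comap Subtype.val) = μ)).quasiMeasurePreserving.ae (h g)
    filter_upwards [this] with x hx
    exact ⟨Set.mem_univ _, hx.symm⟩

/-- A boolean isomorphism extends to a measure-preserving Borel map defined everywhere, which has
a Borel inverse almost everywhere. -/
theorem BooleanlyIsomorphic.exists_measurePreserving [StandardBorelSpace X] [StandardBorelSpace Y]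
    (hμ : μ ≠ 0) {α : BooleanAction G X μ} {β : BooleanAction G Y η}
    (h : α.BooleanlyIsomorphic β) :
    ∃ (Φ : X → Y) (Ψ : Y → X), MeasurePreserving Φ μ η ∧ MeasurePreserving Ψ η μ ∧
      (∀ᵐ x ∂μ, Ψ (Φ x) = x) ∧ ∀ g, ∀ᵐ x ∂μ, Φ (α.act g x) = β.act g (Φ x) := by
  obtain ⟨X₀, φ, hX₀, hX₀c, hinj, hφ, hequi⟩ := h
  have hae : ∀ᵐ x ∂μ, x ∈ X₀ := hX₀c
  have : NeBot (ae μ) := ae_neBot.2 hμ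
  obtain ⟨x₀, hx₀⟩ := hae.exists
  have : StandardBorelSpace X₀ := hX₀.standardBorel
  have hemb : MeasurableEmbedding φ := hφ.measurable.measurableEmbedding hinj
  have hval : MeasurableEmbedding (Subtype.val : X₀ → X) := .subtype_coe hX₀
  have hmap : (μ.comap (Subtype.val : X₀ → X)).map Subtype.val = μ := by
    rw [map_comap_subtype_coe hX₀, Measure.restrict_eq_self_of_ae_mem hae]
  obtain ⟨Φ, hΦ, hΦφ⟩ := hval.exists_measurable_extend hφ.measurable fun _ => ⟨φ ⟨x₀, hx₀⟩⟩
  obtain ⟨Ψ₀, hΨ₀, hΨφ⟩ := hemb.exists_measurable_extend measurable_id fun _ => ⟨⟨x₀, hx₀⟩⟩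
  have hΦ' (x : X₀) : Φ x = φ x := congrFun hΦφ x
  have hΨ' (x : X₀) : Ψ₀ (φ x) = x := congrFun hΨφ x
  have hΦmp : MeasurePreserving Φ μ η := ⟨hΦ, by
    rw [← hmap, Measure.map_map hΦ measurable_subtype_coe, hΦφ, hφ.map_eq]⟩
  have hinv : ∀ᵐ x ∂μ, (Ψ₀ (Φ x) : X) = x := by
    filter_upwards [hae] with x hx
    rw [hΦ' ⟨x, hx⟩, hΨ' ⟨x, hx⟩]
  have hΨ : Measurable fun y => (Ψ₀ y : X) := measurable_subtype_coe.comp hΨ₀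
  refine ⟨Φ, fun y => Ψ₀ y, hΦmp, ⟨hΨ, ?_⟩, hinv, fun g => ?_⟩
  · rw [← hΦmp.map_eq, Measure.map_map hΨ hΦ]
    exact (Measure.map_congr hinv).trans Measure.map_id
  · suffices h : ∀ᵐ x ∂(μ.comap (Subtype.val : X₀ → X)).map Subtype.val,
        Φ (α.act g x) = β.act g (Φ x) by rwa [hmap] at h
    rw [hval.ae_map_iff]
    filter_upwards [hequi g] with x hx
    obtain ⟨hx', hx⟩ := hx
    rw [hΦ' x, ← hx, ← hΦ' ⟨_, hx'⟩]

/-- A boolean action with a continuous Radon model has an `L^p`-dense set of `G`-continuous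
functions. -/
theorem AdmitsContinuousRadonModel.dense_gContinuousInter {G : Type v} {X : Type u} [Group G]
    [TopologicalSpace G] [IsTopologicalGroup G] [MeasurableSpace G] [MeasurableSpace X]
    [StandardBorelSpace X] {μ : Measure X} (hμ : μ ≠ 0) {α : BooleanAction G X μ}
    (h : α.AdmitsContinuousRadonModel) {p : ℝ≥0∞} [Fact (1 ≤ p)] (hp : p ≠ ∞) :
    Dense (α.gContinuousInter p) := by
  obtain ⟨Y, _, _, η, β, _, _, _, _, ⟨⟨hone, hmul⟩, hβ⟩, hiso⟩ := h
  obtain ⟨Φ, Ψ, hΦ, hΨ, hinv, hequi⟩ := hiso.exists_measurePreserving hμ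
  refine Metric.dense_iff.2 fun k r hr => ?_
  have hk : MemLp (k ∘ Ψ) p η := (Lp.memLp k).comp_measurePreserving hΨ
  -- The approximation is made on `Y` and pulled back along `Φ`; since `Ψ ∘ Φ` is almost everywhere
  -- the identity, the error is preserved.
  obtain ⟨f, hfc, hfk, hf, hfp⟩ := hk.exists_hasCompactSupport_eLpNorm_sub_le hp
    (ε := ENNReal.ofReal (r / 2)) (by simpa using hr)
  have hfΦ : MemLp (f ∘ Φ) p μ := hfp.comp_measurePreserving hΦ
  obtain ⟨c, hc⟩ := hfc.exists_bound_of_continuous hf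
  have hftop : MemLp (f ∘ Φ) ∞ μ :=
    memLp_top_of_bound hfΦ.aestronglyMeasurable c (ae_of_all _ fun x => hc _)
  refine ⟨hfΦ.toLp, ?_, hftop.toLp, ?_, ?_⟩
  · have hkΦ : k ∘ Ψ ∘ Φ =ᵐ[μ] k := by
      filter_upwards [hinv] with x hx
      rw [Function.comp_apply, Function.comp_apply, hx]
    have h1 : eLpNorm (f ∘ Φ - (k : X → ℂ)) p μ ≤ ENNReal.ofReal (r / 2) := by
      rw [← neg_sub, eLpNorm_neg]
      refine le_of_eq_of_le ?_ hfk
      rw [← eLpNorm_comp_measurePreserving (hk.sub hfp).aestronglyMeasurable hΦ]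
      refine eLpNorm_congr_ae ?_
      filter_upwards [hkΦ] with x hx
      simp only [Function.comp_apply, Pi.sub_apply] at hx ⊢
      rw [hx]
    rw [Metric.mem_ball, Lp.dist_def, eLpNorm_congr_ae (hfΦ.coeFn_toLp.sub (ae_eq_refl k))]
    refine lt_of_le_of_lt (ENNReal.toReal_le_of_le_ofReal (by positivity) h1) (by linarith)
  · refine Metric.tendsto_nhds.2 fun ε hε => ?_
    filter_upwards [hfc.eventually_norm_sub_comp_le hβ hone hmul hf (half_pos hε)] with g hg
    rw [dist_zero_right, norm_norm]
    refine lt_of_le_of_lt (Lp.norm_le_of_ae_norm_le_top _ (half_pos hε).le ?_) (half_lt_self hε)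
    filter_upwards [Lp.coeFn_sub hftop.toLp (α.translate g hftop.toLp), hftop.coeFn_toLp,
      Lp.coeFn_compMeasurePreserving hftop.toLp (α.measurePreserving_act g⁻¹),
      (α.measurePreserving_act g⁻¹).quasiMeasurePreserving.ae hftop.coeFn_toLp, hequi g⁻¹]
      with x h1 h2 h3 h4 h5
    rw [h1, Pi.sub_apply, h2, translate, h3, Function.comp_apply, Function.comp_apply, h4,
      Function.comp_apply, h5]
    exact hg _
  · exact AEEqFun.mk_eq_mk.2 (ae_eq_refl _)

theorem LiftsToContinuousRadon.admitsContinuousRadonModel {G : Type v} {X : Type u} [Group G]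
    [TopologicalSpace G] [MeasurableSpace G] [MeasurableSpace X] {μ : Measure X}
    {α : BooleanAction G X μ} (h : α.LiftsToContinuousRadon) : α.AdmitsContinuousRadonModel := by
  obtain ⟨τ, hP, hL, hB, hR, β, hβ, hαβ⟩ := h
  exact ⟨X, τ, _, μ, β, hP, hL, hB, hR, hβ, booleanlyIsomorphic_of_ae_eq hαβ⟩

end BooleanAction

theorem theoremC {G : Type*} [Group G] [TopologicalSpace G] [IsTopologicalGroup G] [PolishSpace G]
    [MeasurableSpace G] [BorelSpace G]
    {X : Type*} [MeasurableSpace X] [StandardBorelSpace X]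
    (μ : Measure X) [SigmaFinite μ] [NullSingletonClass μ] (hμ : μ ≠ 0)
    (α : BooleanAction G X μ) :
    List.TFAE [
      Dense (α.gContinuousInter 1),
      Dense (α.gContinuousInter 2),
      α.AdmitsContinuousRadonModel,
      α.LiftsToContinuousRadon] := by
  tfae_have 1 → 4 := α.liftsToContinuousRadon_of_dense hμ ENNReal.one_ne_top
  tfae_have 2 → 4 := α.liftsToContinuousRadon_of_dense hμ ENNReal.ofNat_ne_top
  tfae_have 4 → 3 := fun h => h.admitsContinuousRadonModel
  tfae_have 3 → 1 := fun h => h.dense_gContinuousInter hμ ENNReal.one_ne_top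
  tfae_have 3 → 2 := fun h => h.dense_gContinuousInter hμ ENNReal.ofNat_ne_top
  tfae_finish
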